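/- Let $\mathbb{A}$ be one of $\mathbb{R},\mathbb{C},\mathbb{H},\mathbb{O}$, where $\mathbb{O}=\mathbb{H}\oplus\mathbb{H}$ has the Cayley--Dickson product $(a,b)(c,d)=(ac-d\bar b,\ \bar a d+cb)$, and let $\mathbb{A}^n$ carry its Euclidean norm and its coordinatewise right multiplication by $\mathbb{A}$; for $\mathbb{A}=\mathbb{H}$ let $n\ge 1$, and for $\mathbb{A}=\mathbb{O}$ let $n=1$. A real linear isometry $\phi$ of $\mathbb{A}^n$ is a *twisted isomorphism* if there is $\theta\in SO(\mathbb{A})$ with $\phi(vx)=\phi(v)\theta(x)$ for all $v\in\mathbb{A}^n$, $x\in\mathbb{A}$; these form a group $G_{\mathbb{A}}(n)$. Define a representation $\lambda_{\mathbb{A}}$ of $G_{\mathbb{A}}(n)$ on $\mathbb{A}$ (projective, with values in $O(\mathbb{H})/\{\pm1\}$, if $\mathbb{A}=\mathbb{H}$) by - $\lambda_{\mathbb{R}}(g)(x)=x\det g$; - $\lambda_{\mathbb{C}}(g)(x)=x\det_{\mathbb{C}}g$ (each $g\in G_{\mathbb{C}}(n)$ is complex linear); - $\lambda_{\mathbb{H}}(g)(x)=x\beta$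 up to sign, where $g(v)=\alpha(v)\beta$ with $\alpha$ a right $\mathbb{H}$-linear isometry of $\mathbb{H}^n$ and $\beta$ a unit quaternion (such a pair $(\alpha,\beta)$ exists and is unique up to a common sign); - $\lambda_{\mathbb{O}}(g)(x)=g(x)$. Let $H_{\mathbb{A}}(n)\subset G_{\mathbb{A}}(n)$ be the subgroup of the $g$ such that $\lambda_{\mathbb{A}}(g)$ fixes $1\in\mathbb{A}$ (for $\mathbb{A}=\mathbb{H}$: such that some representative of $\lambda_{\mathbb{H}}(g)$ in $O(\mathbb{H})$ fixes $1$). Then, as groups of transformations of $\mathbb{A}^n$, $$H_{\mathbb{R}}(n)=SO(n),\qquad H_{\mathbb{C}}(n)=SU(n),\qquad H_{\mathbb{H}}(n)=Sp(n),\qquad H_{\mathbb{O}}(1)=G_2 .$$ Here $SO(n)$, $SU(n)$ and the group $Sp(n)$ of $n\times n$ quaternionic matrices $A$ with $A^*A=AA^*=1$ act on column vectors by $v\mapsto Av$, and $G_2$ is the group of automorphisms of the real algebra $\mathbb{O}$. -/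

import Mathlib

open scoped Quaternion RightActions

noncomputable section

namespace NormedDivAlg

/-! ### Twisted isomorphisms

`A` is a normed algebra, `V` a normed linear `A`-space.  The right multiplication `v x` is the
Mathlib action of the opposite, written `v <• x`; on `A` itself it is `v * x`, on `Aⁿ` it is
coordinatewise. -/

section Twisted

variable (A : Type*) [NormedAddCommGroup A] [NormedSpace ℝ A]
variable (V : Type*) [NormedAddCommGroup V] [NormedSpace ℝ V] [SMul Aᵐᵒᵖ V]

/-- The group of twisted isomorphisms of `V`: the real linear isometries `φ` of `V` such that
`φ (v x) = φ v * θ x` for some `θ ∈ SO(A)`. -/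
def twistedIso : Subgroup (V ≃ₗᵢ[ℝ] V) where
  carrier := {φ | ∃ θ : A ≃ₗᵢ[ℝ] A, LinearMap.det (θ.toLinearEquiv : A →ₗ[ℝ] A) = 1 ∧
    ∀ (v : V) (x : A), φ (v <• x) = φ v <• θ x}
  one_mem' := by
    refine ⟨1, ?_, fun v x => rfl⟩
    exact LinearMap.det_id
  mul_mem' := by
    rintro φ ψ ⟨θ, hθ, h⟩ ⟨η, hη, k⟩
    refine ⟨θ * η, ?_, fun v x => ?_⟩
    · have : (((θ * η).toLinearEquiv : A ≃ₗ[ℝ] A) : A →ₗ[ℝ] A) =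
          (θ.toLinearEquiv : A →ₗ[ℝ] A) ∘ₗ (η.toLinearEquiv : A →ₗ[ℝ] A) := rfl
      rw [this, LinearMap.det_comp, hθ, hη, one_mul]
    · change φ (ψ (v <• x)) = φ (ψ v) <• θ (η x)
      rw [k, h]
  inv_mem' := by
    rintro φ ⟨θ, hθ, h⟩
    refine ⟨θ⁻¹, ?_, fun v x => ?_⟩
    · have h1 : (θ.toLinearEquiv : A →ₗ[ℝ] A) ∘ₗ ((θ⁻¹).toLinearEquiv : A →ₗ[ℝ] A) =
          LinearMap.id := by
        ext x
        exact θ.apply_symm_apply x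
      have h2 := congrArg LinearMap.det h1
      rwa [LinearMap.det_comp, hθ, one_mul, LinearMap.det_id] at h2
    · change φ.symm (v <• x) = φ.symm v <• θ.symm x
      rw [LinearIsometryEquiv.symm_apply_eq, h]
      simp

/-- The group of automorphisms of `V`: the real linear isometries `φ` with `φ (v x) = φ v x`. -/
def autGroup : Subgroup (V ≃ₗᵢ[ℝ] V) where
  carrier := {φ | ∀ (v : V) (x : A), φ (v <• x) = φ v <• x}
  one_mem' := fun _ _ => rfl
  mul_mem' := by
    intro φ ψ h k v x
    change φ (ψ (v <• x)) = φ (ψ v) <• x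
    rw [k, h]
  inv_mem' := by
    intro φ h v x
    change φ.symm (v <• x) = φ.symm v <• x
    rw [LinearIsometryEquiv.symm_apply_eq, h]
    simp

end Twisted

/-- `Aⁿ` with the Euclidean norm. -/
abbrev Space (A : Type*) (n : ℕ) : Type _ := PiLp 2 (fun _ : Fin n => A)

/-- The group of twisted isomorphisms of `Aⁿ`. -/
abbrev G (A : Type*) [NormedAddCommGroup A] [NormedSpace ℝ A] [Mul A] (n : ℕ) :
    Subgroup (Space A n ≃ₗᵢ[ℝ] Space A n) :=
  twistedIso A (Space A n)

/-- Given an orthogonal representation `ρ` on `A`, the subgroup of elements fixing `1 ∈ A`. -/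
def stabOne {A : Type*} [NormedAddCommGroup A] [NormedSpace ℝ A] [One A]
    {Γ : Type*} [Group Γ] (ρ : Γ →* (A ≃ₗᵢ[ℝ] A)) : Subgroup Γ where
  carrier := {g | ρ g 1 = 1}
  one_mem' := by simp
  mul_mem' := by
    intro a b (ha : ρ a 1 = 1) (hb : ρ b 1 = 1)
    simp [ha, hb]
  inv_mem' := by
    intro a (ha : ρ a 1 = 1)
    change ρ a⁻¹ 1 = 1
    rw [map_inv]
    change (ρ a).symm 1 = 1
    rw [LinearIsometryEquiv.symm_apply_eq, ha]

/-- Right multiplication `x ↦ x u` by a unit vector `u`, as an isometry. -/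
def mulRight {A : Type*} [NormedDivisionRing A] [NormedAlgebra ℝ A]
    (u : Metric.sphere (0 : A) 1) : A ≃ₗᵢ[ℝ] A where
  toFun x := x * u
  invFun x := x * (u : A)⁻¹
  map_add' x y := add_mul x y _
  map_smul' r x := smul_mul_assoc r x _
  left_inv x := by
    have : (u : A) ≠ 0 := ne_zero_of_mem_unit_sphere u
    simp [this]
  right_inv x := by
    have : (u : A) ≠ 0 := ne_zero_of_mem_unit_sphere u
    simp [this]
  norm_map' x := by
    change ‖x * (u : A)‖ = ‖x‖
    simp

theorem mulRight_apply {A : Type*} [NormedDivisionRing A] [NormedAlgebra ℝ A]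
    (u : Metric.sphere (0 : A) 1) (x : A) : mulRight u x = x * u := rfl

/-! ### The real case -/

theorem norm_det_eq_one {𝕜 E : Type*} [RCLike 𝕜] [NormedAddCommGroup E] [InnerProductSpace 𝕜 E]
    [FiniteDimensional 𝕜 E] (f : E →ₗ[𝕜] E) (hf : ∀ x, ‖f x‖ = ‖x‖) :
    LinearMap.det f ∈ Metric.sphere (0 : 𝕜) 1 := by
  have := LinearIsometry.normDet_eq_one (⟨f, hf⟩ : E →ₗᵢ[𝕜] E)
  rw [LinearMap.normDet_eq_norm_det] at this
  simpa using this

/-- `λ_ℝ(g)(x) = x det g`. -/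
def lambdaR (n : ℕ) : G ℝ n →* (ℝ ≃ₗᵢ[ℝ] ℝ) where
  toFun g := mulRight ⟨LinearMap.det
    ((g : Space ℝ n ≃ₗᵢ[ℝ] Space ℝ n).toLinearEquiv : Space ℝ n →ₗ[ℝ] Space ℝ n),
    norm_det_eq_one _ fun x => (g : Space ℝ n ≃ₗᵢ[ℝ] Space ℝ n).norm_map x⟩
  map_one' := by
    ext x
    simp only [mulRight_apply]
    exact (congrArg (x * ·) LinearMap.det_id).trans (mul_one x)
  map_mul' g h := by
    ext x
    change x * LinearMap.det (_ ∘ₗ _) = x * LinearMap.det _ * LinearMap.det _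
    rw [LinearMap.det_comp, mul_assoc, mul_comm (LinearMap.det _)]

/-- The group of special twisted isomorphisms of `ℝⁿ`. -/
def HR (n : ℕ) : Subgroup (G ℝ n) := stabOne (lambdaR n)

/-! ### The complex case -/

theorem map_smul_complex {n : ℕ} (g : G ℂ n) (c : ℂ) (v : Space ℂ n) :
    (g : Space ℂ n ≃ₗᵢ[ℝ] Space ℂ n) (c • v) = c • (g : Space ℂ n ≃ₗᵢ[ℝ] Space ℂ n) v := by
  obtain ⟨φ, θ, hθ, h⟩ := g
  change φ (c • v) = c • φ v
  have hop : ∀ (w : Space ℂ n) (x : ℂ), w <• x = x • w := fun w x => by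
    ext i
    simp [mul_comm]
  simp only [hop] at h
  by_cases hv : φ v = 0
  · have hv0 : v = 0 := by simpa using hv
    simp [hv0]
  have h1 : θ 1 = 1 := by
    have := h v 1
    rw [one_smul] at this
    have h2 : (1 - θ 1) • φ v = 0 := by rw [sub_smul, one_smul, ← this, sub_self]
    rcases smul_eq_zero.1 h2 with h3 | h3
    · exact (sub_eq_zero.1 h3).symm
    · exact absurd h3 hv
  rw [h]
  rcases linear_isometry_complex_aux h1 with rfl | rfl
  · rfl
  · rw [Complex.det_conjLIE] at hθ
    norm_num at hθ

/-- A twisted isomorphism of `ℂⁿ` as a complex linear map. -/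
def toComplexLinear {n : ℕ} (g : G ℂ n) : Space ℂ n →ₗ[ℂ] Space ℂ n where
  toFun v := (g : Space ℂ n ≃ₗᵢ[ℝ] Space ℂ n) v
  map_add' v w := map_add _ v w
  map_smul' c v := map_smul_complex g c v

/-- `λ_ℂ(g)(x) = x det_ℂ g`. -/
def lambdaC (n : ℕ) : G ℂ n →* (ℂ ≃ₗᵢ[ℝ] ℂ) where
  toFun g := mulRight ⟨LinearMap.det (toComplexLinear g),
    norm_det_eq_one _ fun x => (g : Space ℂ n ≃ₗᵢ[ℝ] Space ℂ n).norm_map x⟩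
  map_one' := by
    ext x
    simp only [mulRight_apply]
    exact (congrArg (x * ·) LinearMap.det_id).trans (mul_one x)
  map_mul' g h := by
    ext x
    change x * LinearMap.det (toComplexLinear g ∘ₗ toComplexLinear h) =
      x * LinearMap.det (toComplexLinear h) * LinearMap.det (toComplexLinear g)
    rw [LinearMap.det_comp, mul_assoc, mul_comm (LinearMap.det _)]

/-- The group of special twisted isomorphisms of `ℂⁿ`. -/
def HC (n : ℕ) : Subgroup (G ℂ n) := stabOne (lambdaC n)

/-! ### The quaternionic case -/

/-- The compact symplectic group `Sp(n)` of quaternionic unitary matrices. -/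
abbrev Sp (n : ℕ) : Submonoid (Matrix (Fin n) (Fin n) ℍ) := unitary (Matrix (Fin n) (Fin n) ℍ)

/-- The subgroup `{1, -1}` of `O(ℍ)`. -/
def signs : Subgroup (ℍ ≃ₗᵢ[ℝ] ℍ) where
  carrier := {L | L = 1 ∨ L = LinearIsometryEquiv.neg ℝ}
  one_mem' := Or.inl rfl
  mul_mem' := by
    rintro a b (rfl | rfl) (rfl | rfl)
    · exact Or.inl rfl
    · exact Or.inr rfl
    · exact Or.inr rfl
    · exact Or.inl (LinearIsometryEquiv.ext fun x => neg_neg x)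
  inv_mem' := by
    rintro a (rfl | rfl)
    · exact Or.inl rfl
    · exact Or.inr rfl

instance : signs.Normal where
  conj_mem := by
    rintro L (rfl | rfl) M
    · exact Or.inl (by simp)
    · refine Or.inr (LinearIsometryEquiv.ext fun x => ?_)
      change M (-(M.symm x)) = -x
      simp

/-- `g = (α, β) ∈ Sp(n) Sp(1)`: the decomposition `g(v) = α(v) β` of `g` into an automorphism `α`
of `ℍⁿ` and a unit quaternion `β`.  The pair `(α, β)` is unique up to a common sign. -/
def HasSpFactor {n : ℕ} (g : Space ℍ n ≃ₗᵢ[ℝ] Space ℍ n) (β : Metric.sphere (0 : ℍ) 1) : Prop :=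
  ∃ α ∈ autGroup ℍ (Space ℍ n), ∀ v, g v = α v <• (β : ℍ)

theorem exists_intertwiner (θ : ℍ → ℍ) (hadd : ∀ x y, θ (x + y) = θ x + θ y)
    (hsmul : ∀ (r : ℝ) x, θ (r • x) = r • θ x) (h1 : θ 1 = 1)
    (hmul : ∀ x y, θ (x * y) = θ x * θ y) :
    ∃ q : ℍ, q ≠ 0 ∧ ∀ x, θ x * q = q * x := by
  obtain ⟨i, i0, i1, i2, i3⟩ : ∃ i : ℍ, i.re = 0 ∧ i.imI = 1 ∧ i.imJ = 0 ∧ i.imK = 0 :=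
    ⟨⟨0, 1, 0, 0⟩, rfl, rfl, rfl, rfl⟩
  obtain ⟨j, j0, j1, j2, j3⟩ : ∃ j : ℍ, j.re = 0 ∧ j.imI = 0 ∧ j.imJ = 1 ∧ j.imK = 0 :=
    ⟨⟨0, 0, 1, 0⟩, rfl, rfl, rfl, rfl⟩
  obtain ⟨k, k0, k1, k2, k3⟩ : ∃ k : ℍ, k.re = 0 ∧ k.imI = 0 ∧ k.imJ = 0 ∧ k.imK = 1 :=
    ⟨⟨0, 0, 0, 1⟩, rfl, rfl, rfl, rfl⟩
  let q : ℍ → ℍ := fun y => y - θ i * y * i - θ j * y * j - θ k * y * k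
  have hij : i * j = k := by ext <;> simp [i0, i1, i2, i3, j0, j1, j2, j3, k0, k1, k2, k3]
  have hji : j * i = -k := by ext <;> simp [i0, i1, i2, i3, j0, j1, j2, j3, k0, k1, k2, k3]
  have hjk : j * k = i := by ext <;> simp [i0, i1, i2, i3, j0, j1, j2, j3, k0, k1, k2, k3]
  have hkj : k * j = -i := by ext <;> simp [i0, i1, i2, i3, j0, j1, j2, j3, k0, k1, k2, k3]
  have hki : k * i = j := by ext <;> simp [i0, i1, i2, i3, j0, j1, j2, j3, k0, k1, k2, k3]
  have hik : i * k = -j := by ext <;> simp [i0, i1, i2, i3, j0, j1, j2, j3, k0, k1, k2, k3]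
  have hii : i * i = -1 := by ext <;> simp [i0, i1, i2, i3]
  have hjj : j * j = -1 := by ext <;> simp [j0, j1, j2, j3]
  have hkk : k * k = -1 := by ext <;> simp [k0, k1, k2, k3]
  have hneg : ∀ x, θ (-x) = -θ x := fun x => by
    have := hsmul (-1) x
    simpa using this
  have hqi : ∀ y, θ i * q y = q y * i := fun y => by
    simp only [q, mul_sub, sub_mul, ← mul_assoc]
    simp only [← hmul, hii, hij, hik, hneg, h1]
    simp only [mul_assoc, hii, hji, hki]
    simp
    abel
  have hqj : ∀ y, θ j * q y = q y * j := fun y => by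
    simp only [q, mul_sub, sub_mul, ← mul_assoc]
    simp only [← hmul, hjj, hji, hjk, hneg, h1]
    simp only [mul_assoc, hjj, hij, hkj]
    simp
    abel
  have hqk : ∀ y, θ k * q y = q y * k := fun y => by
    rw [← hij, hmul, mul_assoc, hqj, ← mul_assoc, hqi, mul_assoc]
  have hne : ∃ y, q y ≠ 0 := by
    by_contra! hq
    have h4 : q 1 - q i * i - q j * j - q k * k = ((4 : ℝ) : ℍ) := by
      simp only [q]
      generalize θ i = I
      generalize θ j = J
      generalize θ k = K
      ext <;> simp [i0, i1, i2, i3, j0, j1, j2, j3, k0, k1, k2, k3] <;> ring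
    simp only [hq] at h4
    have := congrArg QuaternionAlgebra.re h4
    simp at this
  obtain ⟨y, hy⟩ := hne
  refine ⟨q y, hy, fun x => ?_⟩
  have hx : x = x.re • (1 : ℍ) + x.imI • i + x.imJ • j + x.imK • k := by
    ext <;> simp [i0, i1, i2, i3, j0, j1, j2, j3, k0, k1, k2, k3]
  rw [hx]
  simp only [hadd, hsmul, h1, add_mul, mul_add, smul_mul_assoc, mul_smul_comm, hqi, hqj, hqk,
    one_mul, mul_one]

theorem smul_op_smul {n : ℕ} (v : Space ℍ n) (x y : ℍ) : v <• x <• y = v <• (x * y) := by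
  ext1 i
  simp [mul_assoc]

theorem eq_of_forall_op_smul {n : ℕ} [NeZero n] {x y : ℍ}
    (h : ∀ v : Space ℍ n, v <• x = v <• y) : x = y := by
  have := congrArg (fun w : Space ℍ n => w 0) (h (WithLp.toLp 2 fun _ => 1))
  simpa using this

theorem exists_hasSpFactor {n : ℕ} [NeZero n] (g : G ℍ n) :
    ∃ β, HasSpFactor (g : Space ℍ n ≃ₗᵢ[ℝ] Space ℍ n) β := by
  obtain ⟨φ, θ, -, h⟩ := g
  have key : ∀ x y : ℍ, (∀ v, φ v <• x = φ v <• y) → x = y := fun x y hxy =>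
    eq_of_forall_op_smul (n := n) fun v => by simpa using hxy (φ.symm v)
  have h1 : θ 1 = 1 := key _ _ fun v => by
    rw [← h]
    simp
  have hmul : ∀ x y, θ (x * y) = θ x * θ y := fun x y => key _ _ fun v => by
    rw [← h, ← smul_op_smul, h, h, smul_op_smul]
  obtain ⟨q, hq, hθq⟩ := exists_intertwiner θ (map_add θ) (map_smul θ) h1 hmul
  set u : ℍ := ‖q‖⁻¹ • q with hu
  have hn : ‖u‖ = 1 := by simp [hu, norm_smul, hq]
  have hθu : ∀ x, θ x * u = u * x := fun x => by simp [hu, hθq]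
  have hu0 : u ≠ 0 := by
    intro h0
    simp [h0] at hn
  let R : Space ℍ n ≃ₗᵢ[ℝ] Space ℍ n :=
    LinearIsometryEquiv.piLpCongrRight 2 fun _ => mulRight ⟨u, by simpa using hn⟩
  have hR : ∀ v, R v = v <• u := fun v => by
    ext1 i
    rfl
  refine ⟨⟨u⁻¹, by simp [hn]⟩, R * φ, fun v x => ?_, fun v => ?_⟩
  · change R (φ (v <• x)) = R (φ v) <• x
    rw [hR, hR, h, smul_op_smul, smul_op_smul, hθu]
  · change φ v = R (φ v) <• u⁻¹
    rw [hR, smul_op_smul, mul_inv_cancel₀ hu0]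
    simp

theorem HasSpFactor.mk_eq {n : ℕ} [NeZero n] {g : Space ℍ n ≃ₗᵢ[ℝ] Space ℍ n}
    {β γ : Metric.sphere (0 : ℍ) 1} (hβ : HasSpFactor g β) (hγ : HasSpFactor g γ) :
    (QuotientGroup.mk (mulRight β) : (ℍ ≃ₗᵢ[ℝ] ℍ) ⧸ signs) = QuotientGroup.mk (mulRight γ) := by
  obtain ⟨a, ha, hga⟩ := hβ
  obtain ⟨b, hb, hgb⟩ := hγ
  have hβ0 : (β : ℍ) ≠ 0 := ne_zero_of_mem_unit_sphere β
  obtain ⟨c, hc⟩ : ∃ c : ℍ, c = (γ : ℍ) * (β : ℍ)⁻¹ := ⟨_, rfl⟩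
  have hab : ∀ v, a v = b v <• c := fun v => by
    have := congrArg (fun w : Space ℍ n => w <• (β : ℍ)⁻¹) ((hga v).symm.trans (hgb v))
    simp only [smul_op_smul, mul_inv_cancel₀ hβ0] at this
    rw [hc, ← this]
    simp
  have hcomm : ∀ x, x * c = c * x := fun x =>
    eq_of_forall_op_smul (n := n) fun v => by
      obtain ⟨w, rfl⟩ := b.surjective v
      rw [← smul_op_smul, ← smul_op_smul, ← hb, ← hab, ← hab, ha]
  have hcn : ‖c‖ = 1 := by simp [hc]
  have hcr : c = (c.re : ℍ) := by
    obtain ⟨i, i0, i1, i2, i3⟩ : ∃ i : ℍ, i.re = 0 ∧ i.imI = 1 ∧ i.imJ = 0 ∧ i.imK = 0 :=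
      ⟨⟨0, 1, 0, 0⟩, rfl, rfl, rfl, rfl⟩
    obtain ⟨j, j0, j1, j2, j3⟩ : ∃ j : ℍ, j.re = 0 ∧ j.imI = 0 ∧ j.imJ = 1 ∧ j.imK = 0 :=
      ⟨⟨0, 0, 1, 0⟩, rfl, rfl, rfl, rfl⟩
    have hi := hcomm i
    have hj := hcomm j
    have e1 := congrArg QuaternionAlgebra.imK hi
    have e2 := congrArg QuaternionAlgebra.imJ hi
    have e3 := congrArg QuaternionAlgebra.imK hj
    simp [i0, i1, i2, i3, j0, j1, j2, j3] at e1 e2 e3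
    ext <;> simp <;> linarith
  have hγc : (γ : ℍ) = c * β := by simp [hc, hβ0]
  have hc1 : c = 1 ∨ c = -1 := by
    rw [hcr, Quaternion.norm_coe, Real.norm_eq_abs, abs_eq zero_le_one] at hcn
    rcases hcn with h | h
    · left
      rw [hcr, h]
      simp
    · right
      rw [hcr, h]
      simp
  rw [QuotientGroup.eq]
  rcases hc1 with h | h
  · left
    have : β = γ := Subtype.ext (by rw [hγc, h, one_mul])
    rw [this, inv_mul_cancel]
  · right
    rw [inv_mul_eq_iff_eq_mul]
    refine LinearIsometryEquiv.ext fun x => ?_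
    change x * (γ : ℍ) = -x * (β : ℍ)
    rw [hγc, h]
    simp

/-- `λ_ℍ(g)(x) = x β` for `g = (α, β) ∈ Sp(n) Sp(1)`.  As `β` is determined by `g` up to sign,
this is a projective representation, with values in `O(ℍ) / {1, -1}`. -/
def lambdaH (n : ℕ) [NeZero n] : G ℍ n →* (ℍ ≃ₗᵢ[ℝ] ℍ) ⧸ signs where
  toFun g := QuotientGroup.mk (mulRight (exists_hasSpFactor g).choose)
  map_one' := by
    have h1 : HasSpFactor ((1 : G ℍ n) : Space ℍ n ≃ₗᵢ[ℝ] Space ℍ n) 1 :=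
      ⟨1, one_mem _, fun v => by simp⟩
    rw [(exists_hasSpFactor (1 : G ℍ n)).choose_spec.mk_eq h1, ← QuotientGroup.mk_one]
    congr 1
    exact LinearIsometryEquiv.ext fun x => mul_one x
  map_mul' g h := by
    obtain ⟨a, ha, hga⟩ := (exists_hasSpFactor g).choose_spec
    obtain ⟨b, hb, hgb⟩ := (exists_hasSpFactor h).choose_spec
    have hgh : HasSpFactor ((g * h : G ℍ n) : Space ℍ n ≃ₗᵢ[ℝ] Space ℍ n)
        ((exists_hasSpFactor h).choose * (exists_hasSpFactor g).choose) := by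
      refine ⟨a * b, mul_mem ha hb, fun v => ?_⟩
      change g.1 (h.1 v) = _
      rw [hgb, hga, ha, smul_op_smul]
      rfl
    rw [(exists_hasSpFactor (g * h)).choose_spec.mk_eq hgh, ← QuotientGroup.mk_mul]
    congr 1
    exact LinearIsometryEquiv.ext fun x => (mul_assoc x _ _).symm

/-- The group of special twisted isomorphisms of `ℍⁿ`: those `g` for which the projective
transformation `λ_ℍ(g)` fixes `1`, that is, some representative of it fixes `1`. -/
def HH (n : ℕ) [NeZero n] : Subgroup (G ℍ n) where
  carrier := {g | ∃ L : ℍ ≃ₗᵢ[ℝ] ℍ, QuotientGroup.mk L = lambdaH n g ∧ L 1 = 1}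
  one_mem' := ⟨1, by simp, rfl⟩
  mul_mem' := by
    rintro a b ⟨L, hL, hL1⟩ ⟨M, hM, hM1⟩
    refine ⟨L * M, by rw [map_mul, ← hL, ← hM, QuotientGroup.mk_mul], ?_⟩
    simp [hL1, hM1]
  inv_mem' := by
    rintro a ⟨L, hL, hL1⟩
    refine ⟨L⁻¹, by rw [map_inv, ← hL, QuotientGroup.mk_inv], ?_⟩
    change L.symm 1 = 1
    rw [LinearIsometryEquiv.symm_apply_eq, hL1]

/-! ### The octonionic case -/

/-- The octonions, as pairs of quaternions with the Euclidean norm. -/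
def Octonion : Type := WithLp 2 (ℍ × ℍ)

namespace Octonion

instance : NormedAddCommGroup Octonion := inferInstanceAs (NormedAddCommGroup (WithLp 2 (ℍ × ℍ)))
instance : InnerProductSpace ℝ Octonion :=
  inferInstanceAs (InnerProductSpace ℝ (WithLp 2 (ℍ × ℍ)))

/-- The octonion `(a, b)`. -/
def mk (a b : ℍ) : Octonion := WithLp.toLp 2 (a, b)

/-- The first component of an octonion. -/
def fst (x : Octonion) : ℍ := (WithLp.ofLp x).1

/-- The second component of an octonion. -/
def snd (x : Octonion) : ℍ := (WithLp.ofLp x).2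

instance : One Octonion := ⟨mk 1 0⟩

/-- The Cayley-Dickson product `(a, b) (c, d) = (a c - d b*, a* d + c b)`. -/
instance : Mul Octonion :=
  ⟨fun x y => mk (x.fst * y.fst - y.snd * star x.snd) (star x.fst * y.snd + y.fst * x.snd)⟩

end Octonion

/-- The group of twisted isomorphisms of the octonionic line `𝕆`. -/
abbrev GO : Subgroup (Octonion ≃ₗᵢ[ℝ] Octonion) := twistedIso Octonion Octonion

/-- `λ_𝕆(g)(x) = g x`. -/
def lambdaO : GO →* (Octonion ≃ₗᵢ[ℝ] Octonion) := GO.subtype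

/-- The group of special twisted isomorphisms of `𝕆`. -/
def HO : Subgroup GO := stabOne lambdaO

/-- The compact group `G₂`: the automorphism group of the real algebra `𝕆`. -/
def G2 : Subgroup (Octonion ≃ₗ[ℝ] Octonion) where
  carrier := {φ | ∀ x y, φ (x * y) = φ x * φ y}
  one_mem' := fun _ _ => rfl
  mul_mem' := by
    intro φ ψ h k x y
    change φ (ψ (x * y)) = φ (ψ x) * φ (ψ y)
    rw [k, h]
  inv_mem' := by
    intro φ h x y
    change φ.symm (x * y) = φ.symm x * φ.symm y
    rw [LinearEquiv.symm_apply_eq, h]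
    simp

end NormedDivAlg

end

namespace NormedDivAlg

/-! For ℝ, ℂ and ℍ, the members of `H` are right linear isometries. Over ℝ every isometry is linear
and over ℂ every twisted isomorphism is; fixing `1` then says that the determinant is 1. Over ℍ,
fixing `1` forces `β = ±1`, which is central, so `g = α β` is itself right linear. Right linear
isometries of `Kⁿ` are exactly the unitary matrices acting on columns, and this is proved once for
all three algebras (`unitaryAction`, `exists_unitaryAction_eq`).

For 𝕆, if `g 1 = 1` then `g x = g (1 x) = θ x`, so the twisting identity says that `g` is
multiplicative. Conversely an automorphism of 𝕆 is twisted by itself, provided that it lies in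
`SO(𝕆)`. It preserves the norm because the norm can be read off from the quadratic equation of an
octonion (`G2.norm_map`).

The determinant is the delicate point (`G2.det_eq_one`). If it were -1, there would be an imaginary
`x ≠ 0` with `φ x = -x`. For imaginary `y ≠ 0` orthogonal to `x`, the map `L_y φ` commutes with
`L_x`, a complex structure up to scale, so its determinant is nonnegative. But `det L_y > 0` and
`det φ = -1`. -/

/-- An isomorphism onto a nested subgroup `H ≤ G ≤ Γ` from an injective homomorphism to `Γ`
with image `H`. -/
theorem exists_mulEquiv_of_range {S Γ : Type*} [Monoid S] [Group Γ] {G : Subgroup Γ}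
    (H : Subgroup G) (f : S →* Γ) (hf : Function.Injective f)
    (hmem : ∀ s, ∃ h : f s ∈ G, (⟨f s, h⟩ : G) ∈ H) (hsurj : ∀ g ∈ H, ∃ s, f s = g.1) :
    ∃ e : S ≃* H, ∀ s, (e s).1.1 = f s := by
  choose h₁ h₂ using hmem
  let F : S →* H := (f.codRestrict G h₁).codRestrict H h₂
  refine ⟨MulEquiv.ofBijective F ⟨fun a b hab => hf ?_, ?_⟩, fun s => rfl⟩
  · exact congrArg (fun t : H => t.1.1) hab
  · rintro ⟨g, hg⟩
    obtain ⟨s, hs⟩ := hsurj g hg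
    exact ⟨s, Subtype.ext (Subtype.ext hs)⟩

/-! ### Right linear isometries of `Kⁿ` and unitary matrices. -/

section Unitary

open Matrix

variable {K : Type*} [NormedDivisionRing K] [NormedAlgebra ℝ K] {n : ℕ}

/-- The matrix of a map `Kⁿ → Kⁿ` on column vectors. -/
def columnMatrix (φ : Space K n → Space K n) : Matrix (Fin n) (Fin n) K :=
  Matrix.of fun i j => φ (WithLp.toLp 2 (Pi.single j 1)) i

/-- Coordinates multiply basis vectors from the right, so right linearity pulls them out on the side
where `mulVec` puts them; this works for noncommutative `K`. -/
theorem columnMatrix_mulVec {φ : Space K n ≃ₗᵢ[ℝ] Space K n} (h : φ ∈ autGroup K (Space K n))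
    (v : Space K n) : WithLp.toLp 2 (columnMatrix φ *ᵥ v.ofLp) = φ v := by
  have hv : v = ∑ j, (WithLp.toLp 2 (Pi.single j 1) : Space K n) <• v j := by
    ext i
    simp [Pi.single_apply]
  conv_rhs => rw [hv, map_sum]
  ext i
  have h' : ∀ (v : Space K n) (x : K), φ (v <• x) = φ v <• x := h
  simp [h', columnMatrix, mulVec, dotProduct]

theorem autGroup_le_twistedIso : autGroup K (Space K n) ≤ G K n := fun _ h =>
  ⟨1, LinearMap.det_id, h⟩

variable [StarRing K]

/-- The hypothesis `hK` is what ties the involution to the norm; it lets ℝ, ℂ and ℍ be treated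
together. -/
theorem star_dotProduct_self (hK : ∀ x : K, star x * x = algebraMap ℝ K (‖x‖ ^ 2))
    (v : Space K n) : star v.ofLp ⬝ᵥ v.ofLp = algebraMap ℝ K (‖v‖ ^ 2) := by
  rw [PiLp.norm_sq_eq_of_L2, map_sum]
  exact Finset.sum_congr rfl fun i _ => hK _

theorem norm_toLp_mulVec (hK : ∀ x : K, star x * x = algebraMap ℝ K (‖x‖ ^ 2))
    {A : Matrix (Fin n) (Fin n) K} (hA : star A * A = 1) (v : Space K n) :
    ‖(WithLp.toLp 2 (A *ᵥ v.ofLp) : Space K n)‖ = ‖v‖ := by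
  have h := star_dotProduct_self hK (WithLp.toLp 2 (A *ᵥ v.ofLp) : Space K n)
  simp only at h
  rw [star_mulVec, ← dotProduct_mulVec, mulVec_mulVec, ← star_eq_conjTranspose, hA, one_mulVec,
    star_dotProduct_self hK] at h
  have := (algebraMap ℝ K).injective h
  exact ((sq_eq_sq₀ (norm_nonneg _) (norm_nonneg _)).1 this).symm

/-- Unitary matrices acting on column vectors, as real linear isometries. -/
def unitaryAction (hK : ∀ x : K, star x * x = algebraMap ℝ K (‖x‖ ^ 2)) :
    unitary (Matrix (Fin n) (Fin n) K) →* (Space K n ≃ₗᵢ[ℝ] Space K n) where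
  toFun A :=
    { toFun := fun v => WithLp.toLp 2 (A.1 *ᵥ v.ofLp)
      invFun := fun v => WithLp.toLp 2 (star A.1 *ᵥ v.ofLp)
      map_add' := fun v w => by simp [mulVec_add]
      map_smul' := fun r v => by simp [mulVec_smul]
      left_inv := fun v => by simp [mulVec_mulVec, Unitary.star_mul_self_of_mem A.2]
      right_inv := fun v => by simp [mulVec_mulVec, Unitary.mul_star_self_of_mem A.2]
      norm_map' := fun v => norm_toLp_mulVec hK (Unitary.star_mul_self_of_mem A.2) v }
  map_one' := by
    ext1 v
    exact congrArg (WithLp.toLp 2) (one_mulVec _)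
  map_mul' A B := by
    ext1 v
    exact congrArg (WithLp.toLp 2) (mulVec_mulVec _ _ _).symm

theorem unitaryAction_apply (hK : ∀ x : K, star x * x = algebraMap ℝ K (‖x‖ ^ 2))
    (A : unitary (Matrix (Fin n) (Fin n) K)) (v : Space K n) :
    unitaryAction hK A v = WithLp.toLp 2 (A.1 *ᵥ v.ofLp) := rfl

theorem unitaryAction_injective (hK : ∀ x : K, star x * x = algebraMap ℝ K (‖x‖ ^ 2)) :
    Function.Injective (unitaryAction (n := n) hK) := fun A B h => Subtype.ext <| by
  refine ext_of_mulVec_single fun i => ?_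
  exact congrArg (fun φ : Space K n ≃ₗᵢ[ℝ] Space K n => (φ (WithLp.toLp 2 (Pi.single i 1))).ofLp) h

theorem unitaryAction_mem_autGroup (hK : ∀ x : K, star x * x = algebraMap ℝ K (‖x‖ ^ 2))
    (A : unitary (Matrix (Fin n) (Fin n) K)) : unitaryAction hK A ∈ autGroup K (Space K n) := by
  intro v x
  ext1 i
  simp [unitaryAction_apply, mulVec, dotProduct, Finset.sum_mul, mul_assoc]

/-- A hermitian matrix over a normed division ring is zero if its hermitian form vanishes. -/
theorem eq_zero_of_hermitian_form {M : Matrix (Fin n) (Fin n) K} (hM : Mᴴ = M)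
    (h : ∀ v, star v ⬝ᵥ (M *ᵥ v) = 0) : M = 0 := by
  have hd : ∀ i, M i i = 0 := fun i => by
    simpa using h (Pi.single i 1)
  ext i j
  by_cases hij : i = j
  · subst hij
    exact hd i
  have hs : star (M i j) = M j i := by
    conv_rhs => rw [← hM]
    rfl
  -- With zero diagonal and `M j i = star (M i j)`, the form at this vector is `2 M i j * star (M i
  -- j)`.
  have := h (Pi.single i 1 + Pi.single j (M j i))
  simp only [mulVec_add, mulVec_single, star_add, dotProduct_add, add_dotProduct, hd, ← hs,
    Pi.star_single, single_dotProduct, star_one, Pi.smul_apply, col_apply, MulOpposite.op_one,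
    one_smul, MulOpposite.smul_eq_mul_unop, MulOpposite.unop_op, star_star, one_mul, mul_zero,
    zero_mul, zero_add, add_zero] at this
  rw [← two_smul ℝ, smul_eq_zero, mul_eq_zero, star_eq_zero, or_self] at this
  exact this.resolve_left two_ne_zero

theorem columnMatrix_mem_unitary (hK : ∀ x : K, star x * x = algebraMap ℝ K (‖x‖ ^ 2))
    {φ : Space K n ≃ₗᵢ[ℝ] Space K n} (h : φ ∈ autGroup K (Space K n)) :
    columnMatrix φ ∈ unitary (Matrix (Fin n) (Fin n) K) := by
  have h₁ : star (columnMatrix φ) * columnMatrix φ = 1 := by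
    -- The matrix `A* A - 1` is hermitian, and its form at `v` is `‖φ v‖² - ‖v‖² = 0`.
    rw [← sub_eq_zero]
    refine eq_zero_of_hermitian_form (by simp [star_eq_conjTranspose]) fun v => ?_
    have e₁ := star_dotProduct_self hK (φ (WithLp.toLp 2 v))
    have e₂ := star_dotProduct_self hK (WithLp.toLp 2 v : Space K n)
    rw [LinearIsometryEquiv.norm_map, ← e₂, ← columnMatrix_mulVec h] at e₁
    simp only [star_mulVec, ← dotProduct_mulVec, mulVec_mulVec] at e₁
    rw [sub_mulVec, one_mulVec, dotProduct_sub, star_eq_conjTranspose, e₁, sub_self]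
  -- The inverse isometry supplies a right inverse, which must coincide with the left inverse `A*`.
  have h₂ : columnMatrix φ * columnMatrix (φ⁻¹ : Space K n ≃ₗᵢ[ℝ] Space K n) = 1 := by
    refine ext_of_mulVec_single fun i => ?_
    have e₁ := columnMatrix_mulVec (inv_mem h) (WithLp.toLp 2 (Pi.single i 1))
    have e₂ := columnMatrix_mulVec h (φ⁻¹ (WithLp.toLp 2 (Pi.single i 1)))
    rw [← e₁] at e₂
    simp only [mulVec_mulVec] at e₂
    rw [one_mulVec, ← WithLp.ofLp_toLp 2 (_ *ᵥ _), e₂, e₁]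
    exact congrArg WithLp.ofLp (φ.apply_symm_apply _)
  exact Unitary.mem_iff.2 ⟨h₁, by rwa [left_inv_eq_right_inv h₁ h₂]⟩

theorem exists_unitaryAction_eq (hK : ∀ x : K, star x * x = algebraMap ℝ K (‖x‖ ^ 2))
    {φ : Space K n ≃ₗᵢ[ℝ] Space K n} (h : φ ∈ autGroup K (Space K n)) :
    ∃ A, unitaryAction hK A = φ :=
  ⟨⟨columnMatrix φ, columnMatrix_mem_unitary hK h⟩,
    LinearIsometryEquiv.ext fun v => columnMatrix_mulVec h v⟩

end Unitary

/-! ### Two facts on real determinants. -/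

/-- A real linear map commuting with a complex structure has nonnegative determinant. -/
theorem det_nonneg_of_commute {V : Type*} [AddCommGroup V] [Module ℝ V] [FiniteDimensional ℝ V]
    {J T : V →ₗ[ℝ] V} {c : ℝ} (hc : 0 < c) (hJ : ∀ v, J (J v) = -(c • v))
    (hT : ∀ v, T (J v) = J (T v)) : 0 ≤ LinearMap.det T := by
  -- Rescaling gives `I² = -1`, hence a complex vector space on which `T` is complex linear; its
  -- real determinant is then `|det_ℂ T|²`.
  set I : Module.End ℝ V := (√c)⁻¹ • J with hI
  have hII : I * I = -1 := by
    ext v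
    have : (√c)⁻¹ * (√c)⁻¹ * c = 1 := by
      rw [← mul_inv, Real.mul_self_sqrt hc.le, inv_mul_cancel₀ hc.ne']
    simp [hI, hJ, smul_smul, this]
  let F : ℂ →ₐ[ℝ] Module.End ℝ V := Complex.liftAux I hII
  let _ : Module ℂ V := Module.compHom V F.toRingHom
  have hsmul : ∀ (z : ℂ) (v : V), z • v = z.re • v + z.im • I v := fun z v => by
    change F z v = _
    simp [F, Complex.liftAux_apply, Algebra.algebraMap_eq_smul_one]
  have : IsScalarTower ℝ ℂ V := ⟨fun r z v => by simp [hsmul, mul_smul]⟩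
  let T' : V →ₗ[ℂ] V :=
    { toFun := T
      map_add' := map_add T
      map_smul' := fun z v => by simp [hsmul, hI, hT] }
  have : Module.Finite ℂ V := Module.Finite.of_restrictScalars_finite ℝ ℂ V
  rw [show T = T'.restrictScalars ℝ from rfl, LinearMap.det_restrictScalars, Algebra.norm_complex_apply]
  exact Complex.normSq_nonneg _

/-- An isometry of determinant `-1` has the eigenvalue `-1`. -/
theorem exists_map_eq_neg {V : Type*} [NormedAddCommGroup V] [InnerProductSpace ℝ V]
    [FiniteDimensional ℝ V] (φ : V ≃ₗᵢ[ℝ] V)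
    (hφ : LinearMap.det (φ.toLinearEquiv : V →ₗ[ℝ] V) = -1) : ∃ x, x ≠ 0 ∧ φ x = -x := by
  obtain ⟨T, hT⟩ : ∃ T : V →ₗ[ℝ] V, T = (φ.toLinearEquiv : V →ₗ[ℝ] V) := ⟨_, rfl⟩
  rw [← hT] at hφ
  have hadj : LinearMap.adjoint (T + 1) = LinearMap.adjoint T + 1 := by
    rw [map_add]
    congr 1
    exact LinearMap.adjoint_id
  have hTT : T * LinearMap.adjoint T = 1 := by
    have hcomp : LinearMap.adjoint T * T = 1 := by
      refine LinearMap.ext fun v => ext_inner_right ℝ fun w => ?_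
      rw [Module.End.mul_apply, LinearMap.adjoint_inner_left, hT]
      exact φ.inner_map_map v w
    exact mul_eq_one_comm.1 hcomp
  have hdet : LinearMap.det (LinearMap.adjoint (T + 1)) = LinearMap.det (T + 1) := by
    let b := stdOrthonormalBasis ℝ V
    rw [← LinearMap.det_toMatrix b.toBasis, LinearMap.toMatrix_adjoint, Matrix.det_conjTranspose,
      LinearMap.det_toMatrix, star_trivial]
  have h0 : LinearMap.det (T + 1) = 0 := by
    -- Taking determinants gives `-det (T + 1) = det (T + 1)`, since a map and its adjoint have the
    -- same real determinant.
    have : T * (LinearMap.adjoint (T + 1)) = T + 1 := by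
      rw [hadj, mul_add, hTT, mul_one, add_comm]
    have := congrArg LinearMap.det this
    rw [map_mul, hφ, hdet] at this
    linarith
  obtain ⟨x, hx, hx0⟩ := (Submodule.ne_bot_iff _).1 (LinearMap.bot_lt_ker_of_det_eq_zero h0).ne'
  subst hT
  exact ⟨x, hx0, eq_neg_of_add_eq_zero_left hx⟩

/-! ### Octonion algebra. -/

namespace Octonion

@[ext]
theorem ext {x y : Octonion} (h₁ : x.fst = y.fst) (h₂ : x.snd = y.snd) : x = y :=
  WithLp.ofLp_injective 2 (Prod.ext h₁ h₂)

@[simp] theorem fst_add (x y : Octonion) : (x + y).fst = x.fst + y.fst := rfl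
@[simp] theorem snd_add (x y : Octonion) : (x + y).snd = x.snd + y.snd := rfl
@[simp] theorem fst_sub (x y : Octonion) : (x - y).fst = x.fst - y.fst := rfl
@[simp] theorem snd_sub (x y : Octonion) : (x - y).snd = x.snd - y.snd := rfl
@[simp] theorem fst_neg (x : Octonion) : (-x).fst = -x.fst := rfl
@[simp] theorem snd_neg (x : Octonion) : (-x).snd = -x.snd := rfl
@[simp] theorem fst_zero : (0 : Octonion).fst = 0 := rfl
@[simp] theorem snd_zero : (0 : Octonion).snd = 0 := rfl
@[simp] theorem fst_smul (r : ℝ) (x : Octonion) : (r • x).fst = r • x.fst := rfl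
@[simp] theorem snd_smul (r : ℝ) (x : Octonion) : (r • x).snd = r • x.snd := rfl
@[simp] theorem fst_mk (a b : ℍ) : (mk a b).fst = a := rfl
@[simp] theorem snd_mk (a b : ℍ) : (mk a b).snd = b := rfl
@[simp] theorem fst_one : (1 : Octonion).fst = 1 := rfl
@[simp] theorem snd_one : (1 : Octonion).snd = 0 := rfl
@[simp] theorem fst_mul (x y : Octonion) :
    (x * y).fst = x.fst * y.fst - y.snd * star x.snd := rfl
@[simp] theorem snd_mul (x y : Octonion) :
    (x * y).snd = star x.fst * y.snd + y.fst * x.snd := rfl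

protected theorem one_mul (x : Octonion) : 1 * x = x := by ext1 <;> simp

protected theorem mul_one (x : Octonion) : x * 1 = x := by ext1 <;> simp

instance : FiniteDimensional ℝ Octonion :=
  inferInstanceAs (FiniteDimensional ℝ (WithLp 2 (ℍ × ℍ)))

theorem inner_def (x y : Octonion) :
    inner ℝ x y = inner ℝ x.fst y.fst + inner ℝ x.snd y.snd := rfl

theorem inner_one_right (x : Octonion) : inner ℝ x 1 = x.fst.re := by
  simp [inner_def, Quaternion.inner_def]

theorem norm_sq_eq (x : Octonion) :
    ‖x‖ ^ 2 = Quaternion.normSq x.fst + Quaternion.normSq x.snd := by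
  rw [← real_inner_self_eq_norm_sq, inner_def, Quaternion.inner_self, Quaternion.inner_self]

/-- Left multiplication by an octonion. -/
noncomputable def mulLeft (x : Octonion) : Octonion →ₗ[ℝ] Octonion where
  toFun y := x * y
  map_add' y z := by ext1 <;> simp [mul_add, add_mul] <;> abel
  map_smul' r y := by ext1 <;> simp [smul_sub]

theorem mulLeft_apply (x y : Octonion) : mulLeft x y = x * y := rfl

protected theorem add_mul (x y z : Octonion) : (x + y) * z = x * z + y * z := by
  ext1 <;> simp [mul_add, add_mul] <;> abel

protected theorem neg_mul (x y : Octonion) : -x * y = -(x * y) := by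
  ext1 <;> simp <;> abel

/-- The quadratic equation of an octonion, from which automorphisms are seen to preserve the norm.
-/
protected theorem mul_self (x : Octonion) : x * x = (2 * x.fst.re) • x - (‖x‖ ^ 2) • 1 := by
  rw [norm_sq_eq]
  ext <;> simp [Quaternion.normSq_def'] <;> ring

/-- Left alternativity combined with `x² = -‖x‖²`. For `x ≠ 0` it makes `mulLeft x` an admissible
`J` in `det_nonneg_of_commute`. -/
theorem mul_mul_self_left {x : Octonion} (hx : x.fst.re = 0) (y : Octonion) :
    x * (x * y) = -((‖x‖ ^ 2) • y) := by
  rw [norm_sq_eq]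
  ext <;> simp [Quaternion.normSq_def', hx] <;> ring

/-- Polarization of `mul_mul_self_left`: orthogonality kills the cross term of `‖x + y‖²`. -/
theorem mul_left_anticomm {x y : Octonion} (hx : x.fst.re = 0) (hy : y.fst.re = 0)
    (hxy : inner ℝ x y = 0) (z : Octonion) : x * (y * z) = -(y * (x * z)) := by
  have h := mul_mul_self_left (x := x + y) (by simp [hx, hy]) z
  have hadd : ∀ a b c : Octonion, a * (b + c) = a * b + a * c := fun a => map_add (mulLeft a)
  rw [norm_add_sq_real, hxy, Octonion.add_mul, Octonion.add_mul, hadd, hadd,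
    mul_mul_self_left hx, mul_mul_self_left hy, mul_zero, add_zero, add_smul] at h
  rw [eq_neg_iff_add_eq_zero]
  have h' := sub_eq_zero.2 h
  rw [← h']
  abel

theorem exists_orthogonal (x : Octonion) :
    ∃ y : Octonion, y ≠ 0 ∧ y.fst.re = 0 ∧ inner ℝ x y = 0 := by
  by_cases hx : x.snd = 0
  · refine ⟨mk 0 1, fun h => ?_, by simp, by simp [inner_def, hx]⟩
    simpa using congrArg snd h
  · obtain ⟨i, i0, i1, i2, i3⟩ : ∃ i : ℍ, i.re = 0 ∧ i.imI = 1 ∧ i.imJ = 0 ∧ i.imK = 0 :=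
      ⟨⟨0, 1, 0, 0⟩, rfl, rfl, rfl, rfl⟩
    -- For a quaternion `b`, the product `b i` is orthogonal to `b`.
    refine ⟨mk 0 (x.snd * i), fun h => ?_, by simp, ?_⟩
    · rcases mul_eq_zero.1 (congrArg snd h) with h | h
      · exact hx h
      · simp [h] at i1
    · simp [inner_def, Quaternion.inner_def, i0, i1, i2, i3]
      ring

/-- The determinant is nonnegative because `mulLeft x` commutes with itself, and nonzero because its
square is the scalar `-‖x‖²`. -/
theorem det_mulLeft_pos {x : Octonion} (hx0 : x ≠ 0) (hx : x.fst.re = 0) :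
    0 < LinearMap.det (mulLeft x) := by
  have hpos : 0 < ‖x‖ ^ 2 := by positivity
  refine lt_of_le_of_ne (det_nonneg_of_commute hpos (J := mulLeft x) (mul_mul_self_left hx)
    fun v => rfl) fun h => ?_
  have h2 : mulLeft x * mulLeft x = (-(‖x‖ ^ 2)) • (1 : Octonion →ₗ[ℝ] Octonion) := by
    refine LinearMap.ext fun y => (mul_mul_self_left hx y).trans ?_
    simp
  have := congrArg LinearMap.det h2
  rw [map_mul, ← h, LinearMap.det_smul, map_one, mul_zero, mul_one] at this
  exact pow_ne_zero _ (neg_ne_zero.2 hpos.ne') this.symm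

end Octonion

/-! ### Automorphisms of 𝕆 and the octonionic case. -/

theorem G2.map_one {φ : Octonion ≃ₗ[ℝ] Octonion} (h : φ ∈ G2) : φ 1 = 1 := by
  obtain ⟨y, hy⟩ := φ.surjective 1
  have h' : φ (1 * y) = φ 1 * φ y := h 1 y
  rw [Octonion.one_mul, hy, Octonion.mul_one] at h'
  exact h'.symm

/-- Applying `φ` to the quadratic equation of `x` gives a second such equation for `φ x`. When `φ x`
is not a real multiple of `1`, the two must have the same coefficients, and one of these is the
squared norm. -/
theorem G2.norm_map {φ : Octonion ≃ₗ[ℝ] Octonion} (h : φ ∈ G2) (x : Octonion) :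
    ‖φ x‖ = ‖x‖ := by
  have h1 := G2.map_one h
  by_cases hx : ∃ r : ℝ, φ x = r • (1 : Octonion)
  · obtain ⟨r, hr⟩ := hx
    have : x = r • (1 : Octonion) := φ.injective (by rw [hr, map_smul, h1])
    rw [hr, ← this]
  · have hsq : φ (x * x) = φ x * φ x := h x x
    rw [Octonion.mul_self, Octonion.mul_self, map_sub, map_smul, map_smul, h1] at hsq
    have hlin : (2 * x.fst.re - 2 * (φ x).fst.re) • φ x = (‖x‖ ^ 2 - ‖φ x‖ ^ 2) • (1 : Octonion) := by
      rw [sub_smul, sub_smul, sub_eq_sub_iff_sub_eq_sub, hsq]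
    have hc : 2 * x.fst.re - 2 * (φ x).fst.re = 0 := by
      by_contra hc
      exact hx ⟨_, by rw [mul_smul, ← hlin, inv_smul_smul₀ hc]⟩
    rw [hc, zero_smul, eq_comm, smul_eq_zero] at hlin
    rcases hlin with h0 | h0
    · exact ((sq_eq_sq₀ (norm_nonneg _) (norm_nonneg _)).1 (sub_eq_zero.1 h0)).symm
    · simpa using congrArg (fun o : Octonion => o.fst.re) h0

/-- An automorphism of `𝕆` as an isometry. -/
noncomputable def G2.toIsometry : G2 →* (Octonion ≃ₗᵢ[ℝ] Octonion) where
  toFun φ := ⟨φ.1, G2.norm_map φ.2⟩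
  map_one' := rfl
  map_mul' _ _ := rfl

theorem G2.det_eq_one (φ : G2) :
    LinearMap.det ((G2.toIsometry φ).toLinearEquiv : Octonion →ₗ[ℝ] Octonion) = 1 := by
  have hmul : ∀ x y, G2.toIsometry φ (x * y) = G2.toIsometry φ x * G2.toIsometry φ y := φ.2
  have h1 : G2.toIsometry φ 1 = 1 := G2.map_one φ.2
  generalize G2.toIsometry φ = ψ at hmul h1
  have hnorm := norm_det_eq_one (ψ.toLinearEquiv : Octonion →ₗ[ℝ] Octonion) ψ.norm_map
  rw [mem_sphere_zero_iff_norm, Real.norm_eq_abs, abs_eq zero_le_one] at hnorm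
  refine hnorm.resolve_right fun hdet => ?_
  obtain ⟨x, hx0, hx⟩ := exists_map_eq_neg ψ hdet
  have hre : x.fst.re = 0 := by
    have := ψ.inner_map_map x 1
    rw [h1, hx, inner_neg_left, Octonion.inner_one_right] at this
    linarith
  obtain ⟨y, hy0, hy, hxy⟩ := Octonion.exists_orthogonal x
  have hpos := Octonion.det_mulLeft_pos hy0 hy
  -- The map `v ↦ y φ(v)` commutes with `L_x`: the sign from `φ x = -x` cancels the sign from `y (x
  -- z) = -x (y z)`.
  have := det_nonneg_of_commute (J := Octonion.mulLeft x) (c := ‖x‖ ^ 2)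
    (T := Octonion.mulLeft y ∘ₗ (ψ.toLinearEquiv : Octonion →ₗ[ℝ] Octonion)) (by positivity)
    (Octonion.mul_mul_self_left hre) fun v => by
      change y * ψ (x * v) = x * (y * ψ v)
      rw [Octonion.mul_left_anticomm hre hy hxy, hmul, hx, Octonion.neg_mul,
        ← Octonion.mulLeft_apply y, map_neg, Octonion.mulLeft_apply]
  rw [LinearMap.det_comp, hdet] at this
  linarith

theorem exists_mulEquiv_HO : ∃ e : G2 ≃* HO, ∀ (φ : G2) (x : Octonion), (e φ).1.1 x = φ.1 x := by
  have hsurj : ∀ g ∈ HO, ∃ φ, G2.toIsometry φ = g.1 := by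
    rintro ⟨g, θ, _, hθ⟩ hg
    have h1 : g 1 = 1 := hg
    -- The twist of an element fixing `1` is the element itself, so twisted linearity becomes
    -- multiplicativity.
    have hgθ : ∀ x, g x = θ x := fun x => by
      have : g (1 * x) = g 1 * θ x := hθ 1 x
      rwa [h1, Octonion.one_mul, Octonion.one_mul] at this
    exact ⟨⟨g.toLinearEquiv, fun x y => (hθ x y).trans (congrArg (g x * ·) (hgθ y).symm)⟩, rfl⟩
  obtain ⟨e, he⟩ := exists_mulEquiv_of_range HO G2.toIsometry
    (fun φ ψ h => Subtype.ext (congrArg LinearIsometryEquiv.toLinearEquiv h))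
    (fun φ => ⟨⟨_, G2.det_eq_one φ, φ.2⟩, G2.map_one φ.2⟩) hsurj
  exact ⟨e, fun φ x => congrArg (· x) (he φ)⟩

/-! ### The real, complex and quaternionic cases. -/

theorem real_star_mul_self (x : ℝ) : star x * x = algebraMap ℝ ℝ (‖x‖ ^ 2) := by
  simp [sq]

theorem complex_star_mul_self (x : ℂ) : star x * x = algebraMap ℝ ℂ (‖x‖ ^ 2) := by
  simpa using Complex.conj_mul' x

theorem quaternion_star_mul_self (x : ℍ) : star x * x = algebraMap ℝ ℍ (‖x‖ ^ 2) := by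
  rw [Quaternion.star_mul_self, Quaternion.normSq_eq_norm_mul_self, sq]
  rfl

theorem mem_autGroup_real {n : ℕ} (φ : Space ℝ n ≃ₗᵢ[ℝ] Space ℝ n) :
    φ ∈ autGroup ℝ (Space ℝ n) := fun v x => by
  have hop : ∀ w : Space ℝ n, w <• x = x • w := fun w => by
    ext i
    simp [mul_comm]
  rw [hop, hop, map_smul]

theorem mem_HR_iff {n : ℕ} (g : G ℝ n) :
    g ∈ HR n ↔ LinearMap.det (g.1.toLinearEquiv : Space ℝ n →ₗ[ℝ] Space ℝ n) = 1 := by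
  change (1 : ℝ) * LinearMap.det (_ : Space ℝ n →ₗ[ℝ] Space ℝ n) = 1 ↔ _
  rw [one_mul]

theorem mem_HC_iff {n : ℕ} (g : G ℂ n) : g ∈ HC n ↔ LinearMap.det (toComplexLinear g) = 1 := by
  change (1 : ℂ) * LinearMap.det (toComplexLinear g) = 1 ↔ _
  rw [one_mul]

theorem mem_autGroup_complex {n : ℕ} (g : G ℂ n) : g.1 ∈ autGroup ℂ (Space ℂ n) := fun v x => by
  have hop : ∀ w : Space ℂ n, w <• x = x • w := fun w => by
    ext i
    simp [mul_comm]
  rw [hop, hop, map_smul_complex]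

/-- A representative of `λ_ℍ(g)` is `x ↦ ±x β`; it can fix `1` only if `β = ±1`. Conversely a right
linear `g` admits the pair `(g, 1)`, and the class of `β` does not depend on the chosen pair. -/
theorem mem_HH_iff {n : ℕ} [NeZero n] (g : G ℍ n) : g ∈ HH n ↔ g.1 ∈ autGroup ℍ (Space ℍ n) := by
  constructor
  · rintro ⟨L, hL, hL1⟩
    obtain ⟨β, hβ⟩ : ∃ β, β = (exists_hasSpFactor g).choose := ⟨_, rfl⟩
    obtain ⟨α, hα, hg⟩ := (exists_hasSpFactor g).choose_spec
    replace hL : (QuotientGroup.mk L : (ℍ ≃ₗᵢ[ℝ] ℍ) ⧸ signs) = QuotientGroup.mk (mulRight β) := by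
      rw [hL, hβ]
      rfl
    rw [← hβ] at hg
    have hα' : ∀ (v : Space ℍ n) (x : ℍ), α (v <• x) = α v <• x := hα
    have hsign : (β : ℍ) = 1 ∨ (β : ℍ) = -1 := by
      rw [QuotientGroup.eq] at hL
      have hβ1 : (mulRight β) 1 = (β : ℍ) := one_mul _
      rcases hL with h | h <;> rw [inv_mul_eq_iff_eq_mul] at h <;> rw [← hβ1, h]
      · exact Or.inl hL1
      · refine Or.inr ?_
        change L (-1) = -1
        rw [map_neg, hL1]
    intro v x
    rcases hsign with h | h <;> simp [hg, h, hα']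
  · intro h
    have h1 : HasSpFactor g.1 1 := ⟨g.1, h, fun v => by simp⟩
    refine ⟨mulRight 1, ?_, one_mul _⟩
    exact h1.mk_eq (exists_hasSpFactor g).choose_spec

theorem exists_mulEquiv_HR (n : ℕ) : ∃ e : Matrix.specialOrthogonalGroup (Fin n) ℝ ≃* HR n,
    ∀ (A : Matrix.specialOrthogonalGroup (Fin n) ℝ) (v : Space ℝ n),
      (e A).1.1 v = WithLp.toLp 2 (A.1.mulVec v.ofLp) := by
  have hmem : ∀ A : Matrix (Fin n) (Fin n) ℝ,
      A ∈ Matrix.specialOrthogonalGroup (Fin n) ℝ ↔ A ∈ unitary _ ∧ A.det = 1 := fun A => Iff.rfl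
  let f : Matrix.specialOrthogonalGroup (Fin n) ℝ →* (Space ℝ n ≃ₗᵢ[ℝ] Space ℝ n) :=
    (unitaryAction real_star_mul_self).comp (Submonoid.inclusion fun A hA => ((hmem A).1 hA).1)
  have hdet : ∀ A : unitary (Matrix (Fin n) (Fin n) ℝ), LinearMap.det
      ((unitaryAction real_star_mul_self A).toLinearEquiv : Space ℝ n →ₗ[ℝ] Space ℝ n) =
        A.1.det := fun A => LinearMap.det_toLpLin 2 A.1
  have hsurj : ∀ g ∈ HR n, ∃ A, f A = g.1 := by
    intro g hg
    obtain ⟨A, hA⟩ := exists_unitaryAction_eq real_star_mul_self (mem_autGroup_real g.1)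
    refine ⟨⟨A.1, (hmem _).2 ⟨A.2, ?_⟩⟩, hA⟩
    rw [← hdet, hA]
    exact (mem_HR_iff g).1 hg
  obtain ⟨e, he⟩ := exists_mulEquiv_of_range (HR n) f
    ((unitaryAction_injective real_star_mul_self).comp (Submonoid.inclusion_injective _))
    (fun A => ⟨autGroup_le_twistedIso (mem_autGroup_real _),
      (mem_HR_iff _).2 ((hdet _).trans ((hmem A.1).1 A.2).2)⟩) hsurj
  exact ⟨e, fun A v => congrArg (· v) (he A)⟩

theorem exists_mulEquiv_HC (n : ℕ) : ∃ e : Matrix.specialUnitaryGroup (Fin n) ℂ ≃* HC n,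
    ∀ (A : Matrix.specialUnitaryGroup (Fin n) ℂ) (v : Space ℂ n),
      (e A).1.1 v = WithLp.toLp 2 (A.1.mulVec v.ofLp) := by
  let f : Matrix.specialUnitaryGroup (Fin n) ℂ →* (Space ℂ n ≃ₗᵢ[ℝ] Space ℂ n) :=
    (unitaryAction complex_star_mul_self).comp
      (Submonoid.inclusion Matrix.specialUnitaryGroup_le_unitaryGroup)
  have hdet : ∀ (g : G ℂ n) (A : unitary (Matrix (Fin n) (Fin n) ℂ)),
      unitaryAction complex_star_mul_self A = g.1 →
        -- The matrix and `g` define the same complex linear map, so the complex determinant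
        -- entering `lambdaC` is the matrix determinant.
        LinearMap.det (toComplexLinear g) = A.1.det := fun g A h => by
    rw [← LinearMap.det_toLpLin 2 A.1]
    congr 1
    exact LinearMap.ext fun v => congrArg (· v) h.symm
  have hsurj : ∀ g ∈ HC n, ∃ A, f A = g.1 := by
    intro g hg
    obtain ⟨A, hA⟩ := exists_unitaryAction_eq complex_star_mul_self (mem_autGroup_complex g)
    refine ⟨⟨A.1, Matrix.mem_specialUnitaryGroup_iff.2 ⟨A.2, ?_⟩⟩, hA⟩
    rw [← hdet g A hA]
    exact (mem_HC_iff g).1 hg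
  obtain ⟨e, he⟩ := exists_mulEquiv_of_range (HC n) f
    ((unitaryAction_injective complex_star_mul_self).comp (Submonoid.inclusion_injective _))
    (fun A => ⟨autGroup_le_twistedIso (unitaryAction_mem_autGroup complex_star_mul_self _),
      (mem_HC_iff _).2 ((hdet _ _ rfl).trans (Matrix.mem_specialUnitaryGroup_iff.1 A.2).2)⟩) hsurj
  exact ⟨e, fun A v => congrArg (· v) (he A)⟩

theorem exists_mulEquiv_HH (n : ℕ) [NeZero n] : ∃ e : Sp n ≃* HH n,
    ∀ (A : Sp n) (v : Space ℍ n), (e A).1.1 v = WithLp.toLp 2 (A.1.mulVec v.ofLp) := by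
  obtain ⟨e, he⟩ := exists_mulEquiv_of_range (HH n) (unitaryAction quaternion_star_mul_self)
    (unitaryAction_injective _)
    (fun A => ⟨autGroup_le_twistedIso (unitaryAction_mem_autGroup _ _),
      (mem_HH_iff _).2 (unitaryAction_mem_autGroup _ _)⟩)
    (fun g hg => exists_unitaryAction_eq _ ((mem_HH_iff g).1 hg))
  exact ⟨e, fun A v => congrArg (· v) (he A)⟩

end NormedDivAlg

theorem mainTheorem3 :
    (∀ n : ℕ, ∃ e : Matrix.specialOrthogonalGroup (Fin n) ℝ ≃* NormedDivAlg.HR n,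
      ∀ (A : Matrix.specialOrthogonalGroup (Fin n) ℝ) (v : NormedDivAlg.Space ℝ n),
        (e A).1.1 v = WithLp.toLp 2 (A.1.mulVec v.ofLp)) ∧
    (∀ n : ℕ, ∃ e : Matrix.specialUnitaryGroup (Fin n) ℂ ≃* NormedDivAlg.HC n,
      ∀ (A : Matrix.specialUnitaryGroup (Fin n) ℂ) (v : NormedDivAlg.Space ℂ n),
        (e A).1.1 v = WithLp.toLp 2 (A.1.mulVec v.ofLp)) ∧
    (∀ (n : ℕ) [NeZero n], ∃ e : NormedDivAlg.Sp n ≃* NormedDivAlg.HH n,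
      ∀ (A : NormedDivAlg.Sp n) (v : NormedDivAlg.Space ℍ n),
        (e A).1.1 v = WithLp.toLp 2 (A.1.mulVec v.ofLp)) ∧
    (∃ e : NormedDivAlg.G2 ≃* NormedDivAlg.HO,
      ∀ (φ : NormedDivAlg.G2) (x : NormedDivAlg.Octonion), (e φ).1.1 x = φ.1 x) :=
  ⟨NormedDivAlg.exists_mulEquiv_HR, NormedDivAlg.exists_mulEquiv_HC,
    NormedDivAlg.exists_mulEquiv_HH, NormedDivAlg.exists_mulEquiv_HO⟩
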